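/- Let $(M,g)$ be a smooth Riemannian manifold (without boundary) of odd dimension $2n+1\ge 3$, with Levi-Civita connection $\nabla$, equipped with an almost contact metric structure $(\phi,\xi,\eta,g)$: $\phi$ is a smooth field of $g$-skew-symmetric endomorphisms of $TM$, $\xi$ is a smooth unit vector field, $\eta=g(\xi,\cdot)$, and $\phi^2=-1+\eta\otimes\xi$. Let $\alpha,\beta\colon M\to\mathbb R$ be smooth functions and suppose that the structure is trans-Sasakian of type $(\alpha,\beta)$, that is, for all vector fields $X,Y$, $$(\nabla_X\phi)(Y)=\alpha\,r(\xi,X)Y+\beta\,r(\xi,\phi X)Y,\qquad\text{where } r(u,v)w=g(v,w)u-g(u,w)v .$$ Then $d\alpha(\xi)=-2\alpha\beta$ on $M$. If moreover $\dim M\ge 5$, then $\alpha\beta=0$ and the gradient $\nabla\alpha$ vanishes identically on $M$. Consequently, if $\dim M\ge 5$ and $M$ is connected, then either $\beta=0$ identically and $\alpha$ is constant (the structure is $\alpha$-Sasakian with $\alpha$ constant), or $\alpha=0$ identically (the structure is $\beta$-Kenmotsu). Here a trans-Sasakian structure of type $(\alpha,\beta)$ is called $\alpha$-Sasakian if $\beta=0$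 and $\beta$-Kenmotsu if $\alpha=0$; the two alternatives are not exclusive. -/

import Mathlib

open Bundle VectorField Module
open scoped Manifold ContDiff

noncomputable section

namespace ACM

/-! Throughout, `M` is a smooth manifold without boundary modelled on the finite-dimensional real
vector space `E` (so `dim M = finrank ℝ E`), with a smooth Riemannian metric `⟪ , ⟫` on its
tangent spaces. -/

section

variable (E : Type*) [NormedAddCommGroup E] [NormedSpace ℝ E] [FiniteDimensional ℝ E]
  {M : Type*} [TopologicalSpace M] [ChartedSpace E M] [IsManifold 𝓘(ℝ, E) ∞ M]
  [RiemannianBundle (fun x : M ↦ TangentSpace 𝓘(ℝ, E) x)]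

instance (x : M) : FiniteDimensional ℝ (TangentSpace 𝓘(ℝ, E) x) :=
  inferInstanceAs (FiniteDimensional ℝ E)

/-- The tangent vector dual, for the Riemannian metric, to a linear form on `T_x M`. -/
def sharp {x : M} (w : TangentSpace 𝓘(ℝ, E) x →L[ℝ] ℝ) : TangentSpace 𝓘(ℝ, E) x :=
  haveI : CompleteSpace (TangentSpace 𝓘(ℝ, E) x) := FiniteDimensional.complete ℝ _
  (InnerProductSpace.toDual ℝ (TangentSpace 𝓘(ℝ, E) x)).symm w

theorem inner_sharp {x : M} (w : TangentSpace 𝓘(ℝ, E) x →L[ℝ] ℝ) (v : TangentSpace 𝓘(ℝ, E) x) :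
    inner ℝ (sharp E w) v = w v := by
  have : CompleteSpace (TangentSpace 𝓘(ℝ, E) x) := FiniteDimensional.complete ℝ _
  exact InnerProductSpace.toDual_symm_apply

/-- The gradient vector field of a function. -/
def grad (f : M → ℝ) (x : M) : TangentSpace 𝓘(ℝ, E) x :=
  sharp E (mvfderiv 𝓘(ℝ, E) f x)

/-- The right-hand side of the Koszul formula, i.e. the function that is to be `⟪∇_X Y, Z⟫`. -/
def koszul (Y X Z : Π x : M, TangentSpace 𝓘(ℝ, E) x) (x : M) : ℝ :=
  (1 / 2 : ℝ) *
    (mvfderiv 𝓘(ℝ, E) (fun p ↦ (inner ℝ (Y p) (Z p) : ℝ)) x (X x)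
      + mvfderiv 𝓘(ℝ, E) (fun p ↦ (inner ℝ (X p) (Z p) : ℝ)) x (Y x)
      - mvfderiv 𝓘(ℝ, E) (fun p ↦ (inner ℝ (X p) (Y p) : ℝ)) x (Z x)
      + inner ℝ (mlieBracket 𝓘(ℝ, E) X Y x) (Z x)
      - inner ℝ (mlieBracket 𝓘(ℝ, E) X Z x) (Y x)
      - inner ℝ (mlieBracket 𝓘(ℝ, E) Y Z x) (X x))

variable [IsContMDiffRiemannianBundle 𝓘(ℝ, E) ∞ E (fun x : M ↦ TangentSpace 𝓘(ℝ, E) x)]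

/-- The inner product of two vector fields that are differentiable at `x` is differentiable
at `x`. -/
theorem mdiffAt_inner {x : M} {X Y : Π x : M, TangentSpace 𝓘(ℝ, E) x}
    (hX : MDiffAt (T% X) x) (hY : MDiffAt (T% Y) x) :
    MDiffAt (fun p ↦ (inner ℝ (X p) (Y p) : ℝ)) x :=
  MDifferentiableAt.inner_bundle (F := E) (E := fun x : M ↦ TangentSpace 𝓘(ℝ, E) x)
    (IB := 𝓘(ℝ, E)) (b := id) hX hY

theorem koszul_tensorial_direction {x : M} (Y Z : Π x : M, TangentSpace 𝓘(ℝ, E) x)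
    (hY : MDiffAt (T% Y) x) (hZ : MDiffAt (T% Z) x) :
    TensorialAt 𝓘(ℝ, E) E (fun X : Π x : M, TangentSpace 𝓘(ℝ, E) x ↦ koszul E Y X Z x) x where
  smul {f X} hf hX := by
    have h1 := mvfderiv_fun_mul hf (mdiffAt_inner E hX hZ)
    have h2 := mvfderiv_fun_mul hf (mdiffAt_inner E hX hY)
    simp [koszul, mlieBracket_smul_left hf hX, inner_add_left, inner_smul_left, inner_smul_right,
      h1, h2]
    simp only [real_inner_comm]
    ring
  add {X X'} hX hX' := by
    have h1 := mvfderiv_fun_add (mdiffAt_inner E hX hZ) (mdiffAt_inner E hX' hZ)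
    have h2 := mvfderiv_fun_add (mdiffAt_inner E hX hY) (mdiffAt_inner E hX' hY)
    simp [koszul, mlieBracket_add_left hX hX', inner_add_left, inner_add_right, h1, h2]
    ring

theorem koszul_tensorial_test {x : M} (Y X : Π x : M, TangentSpace 𝓘(ℝ, E) x)
    (hY : MDiffAt (T% Y) x) (hX : MDiffAt (T% X) x) :
    TensorialAt 𝓘(ℝ, E) E (fun Z : Π x : M, TangentSpace 𝓘(ℝ, E) x ↦ koszul E Y X Z x) x where
  smul {f Z} hf hZ := by
    have h1 := mvfderiv_fun_mul hf (mdiffAt_inner E hX hZ)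
    have h2 := mvfderiv_fun_mul hf (mdiffAt_inner E hY hZ)
    simp [koszul, mlieBracket_smul_right hf hZ, inner_add_left, inner_smul_left, inner_smul_right,
      h1, h2]
    simp only [real_inner_comm]
    ring
  add {Z Z'} hZ hZ' := by
    have h1 := mvfderiv_fun_add (mdiffAt_inner E hX hZ) (mdiffAt_inner E hX hZ')
    have h2 := mvfderiv_fun_add (mdiffAt_inner E hY hZ) (mdiffAt_inner E hY hZ')
    simp [koszul, mlieBracket_add_right hZ hZ', inner_add_left, inner_add_right, h1, h2]
    ring

/-- The bilinear form `(v, w) ↦ ⟪∇_v Y, w⟫` on `T_x M`, for `Y` differentiable at `x`. -/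
def koszulForm {x : M} (Y : Π x : M, TangentSpace 𝓘(ℝ, E) x) (hY : MDiffAt (T% Y) x) :
    TangentSpace 𝓘(ℝ, E) x →L[ℝ] TangentSpace 𝓘(ℝ, E) x →L[ℝ] ℝ :=
  TensorialAt.mkHom₂ (I := 𝓘(ℝ, E)) (F := E) (F' := E)
    (V := fun x : M ↦ TangentSpace 𝓘(ℝ, E) x) (V' := fun x : M ↦ TangentSpace 𝓘(ℝ, E) x)
    (fun X Z ↦ koszul E Y X Z x) x
    (fun Z hZ ↦ koszul_tensorial_direction E Y Z hY hZ)
    (fun X hX ↦ koszul_tensorial_test E Y X hY hX)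

theorem koszulForm_apply {x : M} {Y X Z : Π x : M, TangentSpace 𝓘(ℝ, E) x}
    (hY : MDiffAt (T% Y) x) (hX : MDiffAt (T% X) x) (hZ : MDiffAt (T% Z) x) :
    koszulForm E Y hY (X x) (Z x) = koszul E Y X Z x :=
  TensorialAt.mkHom₂_apply (I := 𝓘(ℝ, E)) (F := E) (F' := E)
    (V := fun x : M ↦ TangentSpace 𝓘(ℝ, E) x) (V' := fun x : M ↦ TangentSpace 𝓘(ℝ, E) x) _ _ hX hZ

open scoped Classical in
/-- The covariant derivative `∇Y` of the Levi-Civita connection: `⟪∇_v Y, w⟫` is given by the Koszul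
formula if `Y` is differentiable at `x`; otherwise the junk value `0` is taken. -/
def leviCivitaFun (Y : Π x : M, TangentSpace 𝓘(ℝ, E) x) (x : M) :
    TangentSpace 𝓘(ℝ, E) x →L[ℝ] TangentSpace 𝓘(ℝ, E) x :=
  if hY : MDiffAt (T% Y) x then
    LinearMap.toContinuousLinearMap
      { toFun := fun v ↦ sharp E (koszulForm E Y hY v)
        map_add' := fun v w ↦ by simp [sharp]
        map_smul' := fun c v ↦ by simp [sharp] }
  else 0

theorem inner_leviCivitaFun {x : M} {X Y Z : Π x : M, TangentSpace 𝓘(ℝ, E) x}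
    (hX : MDiffAt (T% X) x) (hY : MDiffAt (T% Y) x) (hZ : MDiffAt (T% Z) x) :
    inner ℝ (leviCivitaFun E Y x (X x)) (Z x) = koszul E Y X Z x := by
  rw [← koszulForm_apply E hY hX hZ, ← inner_sharp E]
  simp only [leviCivitaFun, hY, dite_true]
  rfl

/-- Two endomorphisms of `T_x M` agree if their pairings on values of vector fields that are
differentiable at `x` agree. -/
theorem ext_of_fields {x : M} {A B : TangentSpace 𝓘(ℝ, E) x →L[ℝ] TangentSpace 𝓘(ℝ, E) x}
    (h : ∀ X Z : Π x : M, TangentSpace 𝓘(ℝ, E) x, MDiffAt (T% X) x → MDiffAt (T% Z) x →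
      (inner ℝ (A (X x)) (Z x) : ℝ) = inner ℝ (B (X x)) (Z x)) : A = B := by
  refine ContinuousLinearMap.ext fun v ↦ ext_inner_right ℝ fun w ↦ ?_
  have := h (FiberBundle.extend E v) (FiberBundle.extend E w)
    (FiberBundle.mdifferentiableAt_extend ..) (FiberBundle.mdifferentiableAt_extend ..)
  simpa using this

variable (M) in
/-- The Levi-Civita connection `∇` of the Riemannian metric, as a covariant derivative on `TM`:
`leviCivita E M Y x v` is `∇_v Y`. -/
def leviCivita : CovariantDerivative 𝓘(ℝ, E) E (fun x : M ↦ TangentSpace 𝓘(ℝ, E) x) where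
  toFun := leviCivitaFun E
  isCovariantDerivativeOnUniv :=
    { add := fun {Y Y' x} hY hY' _ ↦ by
        have hs : MDiffAt (T% (Y + Y')) x := mdifferentiableAt_add_section hY hY'
        refine ext_of_fields E fun X Z hX hZ ↦ ?_
        have h1 := mvfderiv_fun_add (mdiffAt_inner E hY hZ) (mdiffAt_inner E hY' hZ)
        have h2 := mvfderiv_fun_add (mdiffAt_inner E hX hY) (mdiffAt_inner E hX hY')
        rw [inner_leviCivitaFun E hX hs hZ]
        simp only [add_apply, inner_add_left]
        rw [inner_leviCivitaFun E hX hY hZ, inner_leviCivitaFun E hX hY' hZ]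
        simp [koszul, mlieBracket_add_right hY hY', mlieBracket_add_left hY hY', inner_add_left,
          inner_add_right, h1, h2]
        ring
      leibniz := fun {Y f x} hY hf _ ↦ by
        have hs : MDiffAt (T% (f • Y)) x := hf.smul_section hY
        refine ext_of_fields E fun X Z hX hZ ↦ ?_
        have h1 := mvfderiv_fun_mul hf (mdiffAt_inner E hY hZ)
        have h2 := mvfderiv_fun_mul hf (mdiffAt_inner E hX hY)
        rw [inner_leviCivitaFun E hX hs hZ]
        simp only [add_apply, inner_add_left, smul_apply,
          inner_smul_left, ContinuousLinearMap.smulRight_apply]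
        rw [inner_leviCivitaFun E hX hY hZ]
        simp [koszul, mlieBracket_smul_right hf hY, mlieBracket_smul_left hf hY, inner_add_left,
          inner_smul_left, inner_smul_right, h1, h2]
        simp only [real_inner_comm]
        ring }

theorem inner_leviCivita {x : M} {X Y Z : Π x : M, TangentSpace 𝓘(ℝ, E) x}
    (hX : MDiffAt (T% X) x) (hY : MDiffAt (T% Y) x) (hZ : MDiffAt (T% Z) x) :
    inner ℝ (leviCivita E M Y x (X x)) (Z x) = koszul E Y X Z x :=
  inner_leviCivitaFun E hX hY hZ

theorem leviCivita_isMetric {x : M} {Y Z : Π x : M, TangentSpace 𝓘(ℝ, E) x}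
    (hY : MDiffAt (T% Y) x) (hZ : MDiffAt (T% Z) x) (v : TangentSpace 𝓘(ℝ, E) x) :
    mvfderiv 𝓘(ℝ, E) (fun p ↦ (inner ℝ (Y p) (Z p) : ℝ)) x v
      = inner ℝ (leviCivita E M Y x v) (Z x) + inner ℝ (Y x) (leviCivita E M Z x v) := by
  have hX : MDiffAt (T% (FiberBundle.extend E v : Π x : M, TangentSpace 𝓘(ℝ, E) x)) x :=
    FiberBundle.mdifferentiableAt_extend ..
  have h1 := inner_leviCivita E hX hY hZ
  have h2 := inner_leviCivita E hX hZ hY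
  simp only [FiberBundle.extend_apply_self] at h1 h2
  rw [real_inner_comm _ (Y x), h1, h2]
  have hc : (fun p ↦ (inner ℝ (Z p) (Y p) : ℝ)) = fun p ↦ inner ℝ (Y p) (Z p) :=
    funext fun p ↦ real_inner_comm _ _
  simp only [koszul, hc, mlieBracket_swap_apply (V := Z) (W := Y), inner_neg_left,
    FiberBundle.extend_apply_self]
  ring

theorem leviCivita_torsionFree {x : M} {X Y : Π x : M, TangentSpace 𝓘(ℝ, E) x}
    (hX : MDiffAt (T% X) x) (hY : MDiffAt (T% Y) x) :
    leviCivita E M Y x (X x) - leviCivita E M X x (Y x) = mlieBracket 𝓘(ℝ, E) X Y x := by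
  refine ext_inner_right ℝ fun w ↦ ?_
  have hZ : MDiffAt (T% (FiberBundle.extend E w : Π x : M, TangentSpace 𝓘(ℝ, E) x)) x :=
    FiberBundle.mdifferentiableAt_extend ..
  have h1 := inner_leviCivita E hX hY hZ
  have h2 := inner_leviCivita E hY hX hZ
  simp only [FiberBundle.extend_apply_self] at h1 h2
  rw [inner_sub_left, h1, h2]
  have hc : (fun p ↦ (inner ℝ (Y p) (X p) : ℝ)) = fun p ↦ inner ℝ (X p) (Y p) :=
    funext fun p ↦ real_inner_comm _ _
  simp only [koszul, hc, mlieBracket_swap_apply (V := Y) (W := X), inner_neg_left,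
    FiberBundle.extend_apply_self]
  ring

/-- The curvature-type operator `r(u, v) w = ⟪v, w⟫ u - ⟪u, w⟫ v`. -/
def curvOp {x : M} (u v w : TangentSpace 𝓘(ℝ, E) x) : TangentSpace 𝓘(ℝ, E) x :=
  (inner ℝ v w : ℝ) • u - (inner ℝ u w : ℝ) • v

variable (M) in
/-- An almost contact metric structure on the Riemannian manifold `M`: a smooth field `phi` of
skew-symmetric endomorphisms and a smooth unit vector field `xi` (the characteristic field), with
`phi² = -1 + η ⊗ ξ`, where the 1-form `η = ⟪ξ, ·⟫` is the metric dual of `ξ`. -/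
structure AlmostContactMetric where
  phi : Π x : M, TangentSpace 𝓘(ℝ, E) x →L[ℝ] TangentSpace 𝓘(ℝ, E) x
  xi : Π x : M, TangentSpace 𝓘(ℝ, E) x
  smooth_phi : ContMDiff 𝓘(ℝ, E) (𝓘(ℝ, E).prod 𝓘(ℝ, E →L[ℝ] E)) ∞
    (fun x ↦ (⟨x, phi x⟩ : TotalSpace (E →L[ℝ] E)
      (fun x : M ↦ TangentSpace 𝓘(ℝ, E) x →L[ℝ] TangentSpace 𝓘(ℝ, E) x)))
  smooth_xi : ContMDiff 𝓘(ℝ, E) (𝓘(ℝ, E).prod 𝓘(ℝ, E)) ∞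
    (fun x ↦ (⟨x, xi x⟩ : TotalSpace E (fun x : M ↦ TangentSpace 𝓘(ℝ, E) x)))
  inner_xi_xi : ∀ x, (inner ℝ (xi x) (xi x) : ℝ) = 1
  phi_skew : ∀ (x : M) (v w : TangentSpace 𝓘(ℝ, E) x),
    (inner ℝ (phi x v) w : ℝ) = - inner ℝ v (phi x w)
  phi_sq : ∀ (x : M) (v : TangentSpace 𝓘(ℝ, E) x),
    phi x (phi x v) = - v + (inner ℝ (xi x) v : ℝ) • xi x

namespace AlmostContactMetric

variable {E}
variable (S : AlmostContactMetric E M)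

/-- `(∇_v φ)(Y) = ∇_v (φ Y) - φ (∇_v Y)` at the point `x`. -/
def nablaPhi (Y : Π x : M, TangentSpace 𝓘(ℝ, E) x) (x : M) (v : TangentSpace 𝓘(ℝ, E) x) :
    TangentSpace 𝓘(ℝ, E) x :=
  leviCivita E M (fun p ↦ S.phi p (Y p)) x v - S.phi x (leviCivita E M Y x v)

/-- The structure is trans-Sasakian of type `(α, β)`: the functions `α`, `β` are smooth, and
`(∇_X φ)(Y) = α r(ξ, X) Y + β r(ξ, φ X) Y` for all vector fields `X`, `Y`. The identity is tensorial
in `X` and `Y`, so it is stated at each point, for tangent vectors `v` and for fields `Y` that are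
differentiable there. -/
def IsTransSasakian (α β : M → ℝ) : Prop :=
  ContMDiff 𝓘(ℝ, E) 𝓘(ℝ, ℝ) ∞ α ∧ ContMDiff 𝓘(ℝ, E) 𝓘(ℝ, ℝ) ∞ β ∧
  ∀ (x : M) (v : TangentSpace 𝓘(ℝ, E) x) (Y : Π x : M, TangentSpace 𝓘(ℝ, E) x),
    MDiffAt (T% Y) x →
      S.nablaPhi Y x v
        = α x • curvOp E (S.xi x) v (Y x) + β x • curvOp E (S.xi x) (S.phi x v) (Y x)

/-- `α`-Sasakian: trans-Sasakian of type `(α, 0)`. -/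
def IsAlphaSasakian (α : M → ℝ) : Prop := S.IsTransSasakian α (fun _ ↦ 0)

/-- `β`-Kenmotsu: trans-Sasakian of type `(0, β)`. -/
def IsBetaKenmotsu (β : M → ℝ) : Prop := S.IsTransSasakian (fun _ ↦ 0) β

end AlmostContactMetric

end

end ACM

end

/-! Write `Ω(v, w) = ⟪φ v, w⟫`. Putting `Y = ξ` in the trans-Sasakian identity gives `∇_X ξ = -α φ X
+ β (X - η(X) ξ)`. Its skew part says `dη = -2αΩ`, while the identity itself gives `dΩ = 2β η ∧ Ω`.
Hence `d(dη) = 0` becomes `(dα + 2αβ η) ∧ Ω = 0`, with no division by `α` (`wedge_eq_zero`).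

On `(ξ, e, φ e)` with `e ⊥ ξ` this yields `dα(ξ) = -2αβ`. If `dim M ≥ 5`, every `u` admits `e ≠ 0`
orthogonal to `ξ`, `u`, `φ u`, and `(u, e, φ e)` yields `dα = -2αβ η` (`mvfderiv_eq`). Then `d(dα) =
0` on `(e, φ e)` with `e ⊥ ξ` gives `αβ dη(e, φ e) = 0`, that is `α²β = 0` (`mul_eq_zero`). So `αβ =
0` and `dα = 0`.

Exterior derivatives are computed on fields that are constant in a chart: their brackets vanish, and
`d² = 0` is the symmetry of second derivatives. -/

noncomputable section

namespace ACM

open Filter Topology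

/-! ### Chart-constant vector fields and derivatives along them -/

section CoordinateFields

/-- The constant vector field on a vector space. -/
def constField {E : Type*} [NormedAddCommGroup E] [NormedSpace ℝ E] (v : E) :
    Π p : E, TangentSpace 𝓘(ℝ, E) p :=
  fun _ ↦ v

theorem contMDiff_constField {E : Type*} [NormedAddCommGroup E] [NormedSpace ℝ E] (v : E) :
    CMDiff ∞ (T% (constField v)) :=
  contMDiff_vectorSpace_iff_contDiff.2 (contDiff_const (c := v))

variable {E : Type*} [NormedAddCommGroup E] [NormedSpace ℝ E] [FiniteDimensional ℝ E]
  {M : Type*} [TopologicalSpace M] [ChartedSpace E M] [IsManifold 𝓘(ℝ, E) ∞ M]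

omit [FiniteDimensional ℝ E] [IsManifold 𝓘(ℝ, E) ∞ M] in
theorem mvfderiv_congr {x : M} {f g : M → ℝ} (h : f =ᶠ[𝓝 x] g) :
    mvfderiv 𝓘(ℝ, E) f x = mvfderiv 𝓘(ℝ, E) g x := by
  ext u
  simp only [mvfderiv, ContinuousLinearMap.comp_apply]
  rw [h.mfderiv_eq]
  rfl

/-- The vector field whose expression in the preferred chart at `x` is constant equal to `v`. -/
def coordField (x : M) (v : TangentSpace 𝓘(ℝ, E) x) : Π p : M, TangentSpace 𝓘(ℝ, E) p :=
  mpullback 𝓘(ℝ, E) 𝓘(ℝ, E) (extChartAt 𝓘(ℝ, E) x) (constField (E := E) v)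

omit [FiniteDimensional ℝ E] in
theorem coordField_self (x : M) (v : TangentSpace 𝓘(ℝ, E) x) : coordField x v x = v := by
  have := mfderiv_extChartAt_self (I := 𝓘(ℝ, E)) (x := x)
  simp only [coordField, mpullback_apply]
  erw [this, ContinuousLinearMap.inverse_id]
  rfl

theorem contMDiffAt_coordField {x y : M} (hy : y ∈ (extChartAt 𝓘(ℝ, E) x).source)
    (v : TangentSpace 𝓘(ℝ, E) x) :
    CMDiffAt ∞ (T% (coordField x v)) y := by
  have : CompleteSpace E := FiniteDimensional.complete ℝ E
  refine ContMDiffAt.mpullback_vectorField_preimage (n := ∞) (contMDiff_constField (E := E) v _) ?_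
    (isInvertible_mfderiv_extChartAt hy) le_rfl
  exact contMDiffAt_extChartAt' (by simpa using hy)

/-- Brackets commute with pullback by the chart, and constant fields on `E` commute. Thus `dη` has
no bracket term on these fields, and torsion-freeness reads `∇_V W = ∇_W V`. -/
theorem mlieBracket_coordField {x y : M} (hy : y ∈ (extChartAt 𝓘(ℝ, E) x).source)
    (v w : TangentSpace 𝓘(ℝ, E) x) :
    mlieBracket 𝓘(ℝ, E) (coordField x v) (coordField x w) y = 0 := by
  have : CompleteSpace E := FiniteDimensional.complete ℝ E
  have : IsManifold 𝓘(ℝ, E) (minSmoothness ℝ 2) M := by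
    rw [minSmoothness_of_isRCLikeNormedField]
    exact IsManifold.of_le (n := ∞) ENat.LEInfty.out
  have h := mpullback_mlieBracket (I := 𝓘(ℝ, E)) (I' := 𝓘(ℝ, E)) (n := ∞)
    (((contMDiff_constField (E := E) v).mdifferentiable (by simp)) (extChartAt 𝓘(ℝ, E) x y))
    (((contMDiff_constField (E := E) w).mdifferentiable (by simp)) (extChartAt 𝓘(ℝ, E) x y))
    (contMDiffAt_extChartAt' (by simpa using hy))
    (by rw [minSmoothness_of_isRCLikeNormedField]; exact ENat.LEInfty.out)
  have h0 : mlieBracket 𝓘(ℝ, E) (constField (E := E) v) (constField (E := E) w)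
      (extChartAt 𝓘(ℝ, E) x y) = 0 := by
    rw [← mlieBracketWithin_univ, mlieBracketWithin_eq_lieBracketWithin]
    have hc (u : E) : fderivWithin ℝ (constField u : E → E) Set.univ (extChartAt 𝓘(ℝ, E) x y) = 0 :=
      fderivWithin_const_apply u
    simp only [lieBracketWithin]
    erw [hc v, hc w]
    exact sub_self (0 : E)
  rw [coordField, coordField, ← h, mpullback_apply, h0, map_zero]

omit [FiniteDimensional ℝ E] in
theorem contDiffAt_comp_extChartAt_symm {x y : M} (hy : y ∈ (extChartAt 𝓘(ℝ, E) x).source)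
    {f : M → ℝ} (hf : CMDiffAt ∞ f y) :
    ContDiffAt ℝ ∞ (f ∘ (extChartAt 𝓘(ℝ, E) x).symm) (extChartAt 𝓘(ℝ, E) x y) := by
  rw [← contMDiffAt_iff_contDiffAt]
  refine ContMDiffAt.comp_of_eq (y := y) hf ?_ ((extChartAt 𝓘(ℝ, E) x).left_inv hy)
  exact (contMDiffOn_extChartAt_symm x).contMDiffAt
    ((isOpen_extChartAt_target x).mem_nhds ((extChartAt 𝓘(ℝ, E) x).map_source hy))

omit [FiniteDimensional ℝ E] in
theorem mvfderiv_comp_extChartAt {x y : M} (hy : y ∈ (extChartAt 𝓘(ℝ, E) x).source) {g : E → ℝ}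
    (hg : DifferentiableAt ℝ g (extChartAt 𝓘(ℝ, E) x y)) (v : TangentSpace 𝓘(ℝ, E) x) :
    mvfderiv 𝓘(ℝ, E) (g ∘ extChartAt 𝓘(ℝ, E) x) y (coordField x v y)
      = fderiv ℝ g (extChartAt 𝓘(ℝ, E) x y) v := by
  rw [mvfderiv_comp_apply y hg.mdifferentiableAt
    (mdifferentiableAt_extChartAt (by simpa using hy))]
  have h1 : mfderiv 𝓘(ℝ, E) 𝓘(ℝ, E) (extChartAt 𝓘(ℝ, E) x) y (coordField x v y) = v := by
    rw [coordField, mpullback_apply]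
    exact (isInvertible_mfderiv_extChartAt hy).self_apply_inverse _
  rw [h1, ← mfderiv_eq_fderiv]
  rfl

omit [FiniteDimensional ℝ E] in
-- Turns derivatives along these fields into partial derivatives in the chart, so that second-order
-- questions are settled in `E`.
theorem mvfderiv_coordField {x y : M} (hy : y ∈ (extChartAt 𝓘(ℝ, E) x).source) {f : M → ℝ}
    (hf : CMDiffAt ∞ f y) (v : TangentSpace 𝓘(ℝ, E) x) :
    mvfderiv 𝓘(ℝ, E) f y (coordField x v y)
      = fderiv ℝ (f ∘ (extChartAt 𝓘(ℝ, E) x).symm) (extChartAt 𝓘(ℝ, E) x y) v := by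
  rw [← mvfderiv_comp_extChartAt hy
    ((contDiffAt_comp_extChartAt_symm hy hf).differentiableAt (by simp))]
  have : f =ᶠ[𝓝 y] (f ∘ (extChartAt 𝓘(ℝ, E) x).symm) ∘ extChartAt 𝓘(ℝ, E) x := by
    filter_upwards [(isOpen_extChartAt_source x).mem_nhds hy] with z hz
    exact congrArg f ((extChartAt 𝓘(ℝ, E) x).left_inv hz).symm
  rw [mvfderiv_congr this]

omit [FiniteDimensional ℝ E] in
theorem mvfderiv_coordField_eventuallyEq {x : M} {f : M → ℝ} (hf : ∀ᶠ y in 𝓝 x, CMDiffAt ∞ f y)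
    (w : TangentSpace 𝓘(ℝ, E) x) :
    (fun p ↦ mvfderiv 𝓘(ℝ, E) f p (coordField x w p)) =ᶠ[𝓝 x]
      (fun e ↦ fderiv ℝ (f ∘ (extChartAt 𝓘(ℝ, E) x).symm) e w) ∘ extChartAt 𝓘(ℝ, E) x := by
  filter_upwards [hf, extChartAt_source_mem_nhds (I := 𝓘(ℝ, E)) x] with y hy hys
  exact mvfderiv_coordField hys hy w

omit [FiniteDimensional ℝ E] in
theorem differentiableAt_fderiv_comp_extChartAt_symm {x : M} {f : M → ℝ}
    (hf : CMDiffAt ∞ f x) :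
    DifferentiableAt ℝ (fderiv ℝ (f ∘ (extChartAt 𝓘(ℝ, E) x).symm)) (extChartAt 𝓘(ℝ, E) x x) :=
  ((contDiffAt_comp_extChartAt_symm (mem_extChartAt_source x) hf).fderiv_right
    (m := 1) (by rw [one_add_one_eq_two]; exact ENat.LEInfty.out)).differentiableAt one_ne_zero

omit [FiniteDimensional ℝ E] in
theorem mdifferentiableAt_mvfderiv_coordField {x : M} {f : M → ℝ}
    (hf : ∀ᶠ y in 𝓝 x, CMDiffAt ∞ f y) (w : TangentSpace 𝓘(ℝ, E) x) :
    MDiffAt (fun p ↦ mvfderiv 𝓘(ℝ, E) f p (coordField x w p)) x := by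
  refine MDifferentiableAt.congr_of_eventuallyEq ?_ (mvfderiv_coordField_eventuallyEq hf w)
  exact ((differentiableAt_fderiv_comp_extChartAt_symm hf.self_of_nhds).clm_apply
    (differentiableAt_const w)).mdifferentiableAt.comp x
    (mdifferentiableAt_extChartAt (mem_chart_source E x))

omit [FiniteDimensional ℝ E] in
theorem fderiv_clm_apply_const {G : E → E →L[ℝ] ℝ} {p : E} (h : DifferentiableAt ℝ G p) (a b : E) :
    fderiv ℝ (fun e ↦ G e b) p a = fderiv ℝ G p a b := by
  rw [fderiv_clm_apply h (differentiableAt_const b)]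
  simp

omit [FiniteDimensional ℝ E] in
/-- Coordinate vector fields commute as derivations. -/
theorem mvfderiv_mvfderiv_coordField_comm {x : M} {f : M → ℝ}
    (hf : ∀ᶠ y in 𝓝 x, CMDiffAt ∞ f y) (v w : TangentSpace 𝓘(ℝ, E) x) :
    mvfderiv 𝓘(ℝ, E) (fun p ↦ mvfderiv 𝓘(ℝ, E) f p (coordField x w p)) x v =
      mvfderiv 𝓘(ℝ, E) (fun p ↦ mvfderiv 𝓘(ℝ, E) f p (coordField x v p)) x w := by
  -- The iterated derivative is the second Fréchet derivative of `f` read in the chart, which is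
  -- symmetric.
  have key (a b : TangentSpace 𝓘(ℝ, E) x) :
      mvfderiv 𝓘(ℝ, E) (fun p ↦ mvfderiv 𝓘(ℝ, E) f p (coordField x b p)) x a =
        fderiv ℝ (fderiv ℝ (f ∘ (extChartAt 𝓘(ℝ, E) x).symm)) (extChartAt 𝓘(ℝ, E) x x) a b := by
    have hd := differentiableAt_fderiv_comp_extChartAt_symm hf.self_of_nhds
    have h1 := mvfderiv_comp_extChartAt (mem_extChartAt_source x)
      (hd.clm_apply (differentiableAt_const b)) a
    rw [coordField_self] at h1
    rw [mvfderiv_congr (mvfderiv_coordField_eventuallyEq hf b)]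
    erw [h1]
    exact fderiv_clm_apply_const hd a b
  rw [key, key]
  exact (contDiffAt_comp_extChartAt_symm (mem_extChartAt_source x)
    hf.self_of_nhds).isSymmSndFDerivAt
      (by rw [minSmoothness_of_isRCLikeNormedField]; exact ENat.LEInfty.out) v w

omit [FiniteDimensional ℝ E] in
/-- A function with vanishing differential on a connected manifold is constant. -/
theorem exists_eq_const_of_mvfderiv_eq_zero [ConnectedSpace M] {f : M → ℝ}
    (hf : ContMDiff 𝓘(ℝ, E) 𝓘(ℝ, ℝ) ∞ f) (h : ∀ x, mvfderiv 𝓘(ℝ, E) f x = 0) :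
    ∃ c : ℝ, ∀ x, f x = c := by
  have hloc : IsLocallyConstant f := by
    rw [IsLocallyConstant.iff_eventually_eq]
    intro x
    -- A ball inside the chart's image is convex, so vanishing derivative there forces constancy.
    obtain ⟨r, hr, hball⟩ := Metric.isOpen_iff.1 (isOpen_extChartAt_target (I := 𝓘(ℝ, E)) x) _
      (mem_extChartAt_target x)
    filter_upwards [extChartAt_source_mem_nhds (I := 𝓘(ℝ, E)) x,
      continuousAt_extChartAt (I := 𝓘(ℝ, E)) x (Metric.ball_mem_nhds _ hr)] with y hy hyr
    have hsrc : ∀ e ∈ Metric.ball (extChartAt 𝓘(ℝ, E) x x) r,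
        (extChartAt 𝓘(ℝ, E) x).symm e ∈ (extChartAt 𝓘(ℝ, E) x).source :=
      fun e he ↦ (extChartAt 𝓘(ℝ, E) x).map_target (hball he)
    have hd : DifferentiableOn ℝ (f ∘ (extChartAt 𝓘(ℝ, E) x).symm)
        (Metric.ball (extChartAt 𝓘(ℝ, E) x x) r) := by
      intro e he
      have := contDiffAt_comp_extChartAt_symm (hsrc e he) (hf _)
      rw [(extChartAt 𝓘(ℝ, E) x).right_inv (hball he)] at this
      exact (this.differentiableAt (by simp)).differentiableWithinAt
    have hz : ∀ e ∈ Metric.ball (extChartAt 𝓘(ℝ, E) x x) r,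
        fderiv ℝ (f ∘ (extChartAt 𝓘(ℝ, E) x).symm) e = 0 := by
      intro e he
      ext v
      have := mvfderiv_coordField (hsrc e he) (hf _) v
      rw [(extChartAt 𝓘(ℝ, E) x).right_inv (hball he), h] at this
      exact this.symm
    have := Metric.isOpen_ball.is_const_of_fderiv_eq_zero
      (convex_ball _ _).isPreconnected hd hz hyr (Metric.mem_ball_self hr)
    rwa [Function.comp_apply, Function.comp_apply, (extChartAt 𝓘(ℝ, E) x).left_inv hy,
      extChartAt_to_inv] at this
  obtain ⟨x₀⟩ := ‹ConnectedSpace M›.toNonempty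
  exact ⟨f x₀, fun x ↦ hloc.apply_eq_of_preconnectedSpace x x₀⟩

end CoordinateFields

/-- Fewer than `dim V` linear conditions have a common nonzero solution. -/
theorem exists_ne_zero_forall_inner_eq_zero {V : Type*} [NormedAddCommGroup V]
    [InnerProductSpace ℝ V] [FiniteDimensional ℝ V] {k : ℕ} (hk : k < finrank ℝ V)
    (a : Fin k → V) : ∃ e : V, e ≠ 0 ∧ ∀ i, inner ℝ (a i) e = (0 : ℝ) := by
  have hlt : finrank ℝ (Fin k → ℝ) < finrank ℝ V := by simpa using hk
  have := LinearMap.ker_ne_bot_of_finrank_lt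
    (f := LinearMap.pi fun i ↦ (innerSL ℝ (a i)).toLinearMap) hlt
  obtain ⟨e, he, h0⟩ := (Submodule.ne_bot_iff _).1 this
  exact ⟨e, h0, fun i ↦ by simpa using congrFun (LinearMap.mem_ker.1 he) i⟩

/-! ### Pointwise algebra of almost contact metric structures -/

section

variable {E : Type*} [NormedAddCommGroup E] [NormedSpace ℝ E]
  {M : Type*} [TopologicalSpace M] [ChartedSpace E M] [IsManifold 𝓘(ℝ, E) ∞ M]
  [RiemannianBundle (fun x : M ↦ TangentSpace 𝓘(ℝ, E) x)]

namespace AlmostContactMetric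

variable (S : AlmostContactMetric E M)

/-- By skewness `‖φ ξ‖² = -⟪ξ, φ² ξ⟫`, and `φ² ξ = -ξ + ξ = 0`. -/
theorem phi_xi (x : M) : S.phi x (S.xi x) = 0 := by
  rw [← inner_self_eq_zero (𝕜 := ℝ), S.phi_skew, S.phi_sq, S.inner_xi_xi]
  simp

theorem inner_xi_phi (x : M) (v : TangentSpace 𝓘(ℝ, E) x) :
    inner ℝ (S.xi x) (S.phi x v) = (0 : ℝ) := by
  rw [← neg_eq_zero, ← S.phi_skew, S.phi_xi, inner_zero_left]

theorem inner_phi_phi (x : M) (v w : TangentSpace 𝓘(ℝ, E) x) :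
    (inner ℝ (S.phi x v) (S.phi x w) : ℝ)
      = inner ℝ v w - inner ℝ (S.xi x) v * inner ℝ (S.xi x) w := by
  rw [S.phi_skew, S.phi_sq, inner_add_right, inner_neg_right, inner_smul_right,
    real_inner_comm (S.xi x) v]
  ring

theorem mdifferentiableAt_xi (x : M) : MDiffAt (T% S.xi) x :=
  S.smooth_xi.mdifferentiable (by simp) x

theorem contMDiffAt_phi_apply {x : M} {Y : Π x : M, TangentSpace 𝓘(ℝ, E) x}
    (hY : CMDiffAt ∞ (T% Y) x) : CMDiffAt ∞ (T% (fun p ↦ S.phi p (Y p))) x :=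
  ContMDiffAt.clm_bundle_apply (F₁ := E) (F₂ := E) (E₁ := fun x : M ↦ TangentSpace 𝓘(ℝ, E) x)
    (E₂ := fun x : M ↦ TangentSpace 𝓘(ℝ, E) x) (b := id) S.smooth_phi.contMDiffAt hY

variable [IsContMDiffRiemannianBundle 𝓘(ℝ, E) ∞ E (fun x : M ↦ TangentSpace 𝓘(ℝ, E) x)]

theorem contMDiffAt_inner_xi {x : M} {Y : Π x : M, TangentSpace 𝓘(ℝ, E) x}
    (hY : CMDiffAt ∞ (T% Y) x) :
    CMDiffAt ∞ (fun p ↦ (inner ℝ (S.xi p) (Y p) : ℝ)) x :=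
  ContMDiffAt.inner_bundle (F := E) (E := fun x : M ↦ TangentSpace 𝓘(ℝ, E) x)
    (IB := 𝓘(ℝ, E)) (b := id) S.smooth_xi.contMDiffAt hY

variable [FiniteDimensional ℝ E]

theorem eventually_contMDiffAt_inner_xi (x : M) (v : TangentSpace 𝓘(ℝ, E) x) :
    ∀ᶠ y in 𝓝 x, CMDiffAt ∞ (fun p ↦ (inner ℝ (S.xi p) (coordField x v p) : ℝ)) y := by
  filter_upwards [extChartAt_source_mem_nhds (I := 𝓘(ℝ, E)) x] with y hy
  exact S.contMDiffAt_inner_xi (contMDiffAt_coordField hy v)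

theorem inner_xi_leviCivita_xi (x : M) (v : TangentSpace 𝓘(ℝ, E) x) :
    inner ℝ (S.xi x) (leviCivita E M S.xi x v) = (0 : ℝ) := by
  have h := leviCivita_isMetric E (S.mdifferentiableAt_xi x) (S.mdifferentiableAt_xi x) v
  simp only [S.inner_xi_xi, mvfderiv_const, zero_apply] at h
  rw [real_inner_comm (S.xi x) (leviCivita E M S.xi x v)] at h
  linarith

/-! ### The covariant derivative of `ξ`, and the identity `d(dη) = 0` -/

variable {S} {α β : M → ℝ}

/-- Since `φ ξ = 0`, the defining identity at `Y = ξ` determines `φ (∇_v ξ)`. -/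
theorem IsTransSasakian.leviCivita_xi (hS : S.IsTransSasakian α β) (x : M)
    (v : TangentSpace 𝓘(ℝ, E) x) :
    leviCivita E M S.xi x v
      = -(α x) • S.phi x v + β x • (v - (inner ℝ (S.xi x) v : ℝ) • S.xi x) := by
  have h := hS.2.2 x v S.xi (S.mdifferentiableAt_xi x)
  have h0 : leviCivita E M (fun p ↦ S.phi p (S.xi p)) x = 0 := by
    simp only [S.phi_xi]
    exact congrFun (leviCivita E M).zero x
  rw [nablaPhi, h0] at h
  -- As `∇_v ξ ⊥ ξ`, where `φ² = -1`, applying `φ` once more recovers `∇_v ξ`.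
  have h1 := congrArg (S.phi x) h
  simp only [curvOp, zero_apply, zero_sub, map_neg, S.phi_sq, S.inner_xi_leviCivita_xi,
    map_add, map_sub, map_smul, S.phi_xi, S.inner_xi_xi, real_inner_comm (S.xi x),
    S.inner_xi_phi] at h1
  simp only [zero_smul, add_zero, neg_neg, one_smul, smul_zero, zero_sub] at h1
  rw [h1]
  module

/-- The formula `dη = -2αΩ`, evaluated on coordinate fields. -/
theorem IsTransSasakian.d_eta_coordField (hS : S.IsTransSasakian α β) {x y : M}
    (hy : y ∈ (extChartAt 𝓘(ℝ, E) x).source) (v w : TangentSpace 𝓘(ℝ, E) x) :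
    mvfderiv 𝓘(ℝ, E) (fun p ↦ (inner ℝ (S.xi p) (coordField x w p) : ℝ)) y (coordField x v y)
      - mvfderiv 𝓘(ℝ, E) (fun p ↦ (inner ℝ (S.xi p) (coordField x v p) : ℝ)) y
        (coordField x w y)
      = -2 * (α y * inner ℝ (S.phi y (coordField x v y)) (coordField x w y)) := by
  have hV := (contMDiffAt_coordField hy v).mdifferentiableAt (by simp)
  have hW := (contMDiffAt_coordField hy w).mdifferentiableAt (by simp)
  have hT := leviCivita_torsionFree E hV hW
  rw [mlieBracket_coordField hy, sub_eq_zero] at hT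
  rw [leviCivita_isMetric E (S.mdifferentiableAt_xi y) hW,
    leviCivita_isMetric E (S.mdifferentiableAt_xi y) hV, hT, hS.leviCivita_xi, hS.leviCivita_xi]
  simp only [inner_add_left, inner_sub_left, inner_smul_left, RCLike.conj_to_real]
  rw [S.phi_skew y (coordField x w y), real_inner_comm _ (coordField x w y),
    real_inner_comm (coordField x w y) (coordField x v y)]
  ring

/-- The derivative of the formula `dη = -2αΩ`. -/
theorem IsTransSasakian.mvfderiv_d_eta_coordField (hS : S.IsTransSasakian α β) (x : M)
    (u v w : TangentSpace 𝓘(ℝ, E) x) :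
    mvfderiv 𝓘(ℝ, E) (fun p ↦ mvfderiv 𝓘(ℝ, E)
        (fun q ↦ (inner ℝ (S.xi q) (coordField x w q) : ℝ)) p (coordField x v p)) x u
      - mvfderiv 𝓘(ℝ, E) (fun p ↦ mvfderiv 𝓘(ℝ, E)
        (fun q ↦ (inner ℝ (S.xi q) (coordField x v q) : ℝ)) p (coordField x w p)) x u
      = -2 * (mvfderiv 𝓘(ℝ, E) α x u * inner ℝ (S.phi x v) w
        + α x * (inner ℝ (α x • curvOp E (S.xi x) u v
            + β x • curvOp E (S.xi x) (S.phi x u) v) w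
          + inner ℝ (S.phi x (leviCivita E M (coordField x v) x u)) w
          - inner ℝ (S.phi x (leviCivita E M (coordField x w) x u)) v)) := by
  have hs := mem_extChartAt_source (I := 𝓘(ℝ, E)) x
  have hV := contMDiffAt_coordField hs v
  have hV' := hV.mdifferentiableAt (by simp)
  have hW := (contMDiffAt_coordField hs w).mdifferentiableAt (by simp)
  have hφ := (S.contMDiffAt_phi_apply hV).mdifferentiableAt (by simp)
  have hα := hS.1.mdifferentiable (by simp) x
  have hn := hS.2.2 x u (coordField x v) hV'
  rw [nablaPhi, sub_eq_iff_eq_add, coordField_self] at hn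
  -- The formula for `dη` holds on the whole chart domain, so both sides can be differentiated at
  -- `x`.
  have he := mvfderiv_congr (E := E) (Filter.eventuallyEq_of_mem
    (extChartAt_source_mem_nhds (I := 𝓘(ℝ, E)) x)
    fun y hy ↦ hS.d_eta_coordField hy v w)
  have hL := mvfderiv_fun_sub
    (mdifferentiableAt_mvfderiv_coordField (S.eventually_contMDiffAt_inner_xi x w) v)
    (mdifferentiableAt_mvfderiv_coordField (S.eventually_contMDiffAt_inner_xi x v) w)
  have hi := mdiffAt_inner E hφ hW
  have hm : MDiffAt (fun p ↦ α p * inner ℝ (S.phi p (coordField x v p)) (coordField x w p)) x :=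
    hα.mul hi
  have h2 := mvfderiv_fun_mul (mdifferentiableAt_const (c := (-2 : ℝ))) hm
  have h3 := mvfderiv_fun_mul hα hi
  simp only [mvfderiv_const, smul_zero, add_zero] at h2 h3
  rw [hL, h2, h3] at he
  have he' := congrArg (fun L : TangentSpace 𝓘(ℝ, E) x →L[ℝ] ℝ ↦ L u) he
  simp only [add_apply, sub_apply, smul_apply, smul_eq_mul, coordField_self] at he'
  rw [he', leviCivita_isMetric E hφ hW, hn, coordField_self, coordField_self,
    S.phi_skew x v, inner_add_left (_ + _), real_inner_comm _ v]
  ring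

/-- The formula `(dα + 2αβη) ∧ Ω = 0`. -/
theorem IsTransSasakian.wedge_eq_zero (hS : S.IsTransSasakian α β) (x : M)
    (u v w : TangentSpace 𝓘(ℝ, E) x) :
    (mvfderiv 𝓘(ℝ, E) α x u + 2 * (α x * β x) * inner ℝ (S.xi x) u) * inner ℝ (S.phi x v) w
      + (mvfderiv 𝓘(ℝ, E) α x v + 2 * (α x * β x) * inner ℝ (S.xi x) v) * inner ℝ (S.phi x w) u
      + (mvfderiv 𝓘(ℝ, E) α x w + 2 * (α x * β x) * inner ℝ (S.xi x) w) * inner ℝ (S.phi x u) v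
      = 0 := by
  have h1 := hS.mvfderiv_d_eta_coordField x u v w
  have h2 := hS.mvfderiv_d_eta_coordField x v w u
  have h3 := hS.mvfderiv_d_eta_coordField x w u v
  have c1 := mvfderiv_mvfderiv_coordField_comm (S.eventually_contMDiffAt_inner_xi x w) u v
  have c2 := mvfderiv_mvfderiv_coordField_comm (S.eventually_contMDiffAt_inner_xi x u) v w
  have c3 := mvfderiv_mvfderiv_coordField_comm (S.eventually_contMDiffAt_inner_xi x v) w u
  have t (a b : TangentSpace 𝓘(ℝ, E) x) : leviCivita E M (coordField x a) x b
      = leviCivita E M (coordField x b) x a := by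
    have hs := mem_extChartAt_source (I := 𝓘(ℝ, E)) x
    have h := leviCivita_torsionFree E ((contMDiffAt_coordField hs b).mdifferentiableAt (by simp))
      ((contMDiffAt_coordField hs a).mdifferentiableAt (by simp))
    rwa [mlieBracket_coordField hs, sub_eq_zero, coordField_self, coordField_self] at h
  rw [t v u] at h1
  rw [t w v] at h2
  rw [t u w] at h3
  simp only [curvOp, inner_add_left, inner_sub_left, inner_smul_left, RCLike.conj_to_real]
    at h1 h2 h3
  rw [S.phi_skew x u w, real_inner_comm (S.phi x w) u, real_inner_comm w u] at h1
  rw [S.phi_skew x v u, real_inner_comm (S.phi x u) v, real_inner_comm u v] at h2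
  rw [S.phi_skew x w v, real_inner_comm (S.phi x v) w, real_inner_comm v w] at h3
  -- In the cyclic sum the second derivatives cancel by `c1`, `c2`, `c3`, the `∇` terms by `t`, and
  -- the `α²` terms by symmetry of the metric. The `β` terms add up to `2αβ η ∧ Ω`. The factor `1 /
  -- 2` removes the `2` of `dη = -2αΩ`.
  linear_combination (1 / 2) * (h1 + h2 + h3 - c1 - c2 - c3)

/-! ### Evaluation on test vectors -/

omit [IsManifold 𝓘(ℝ, E) ∞ M]
  [IsContMDiffRiemannianBundle 𝓘(ℝ, E) ∞ E (fun x : M ↦ TangentSpace 𝓘(ℝ, E) x)] in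
theorem exists_tangent_ne_zero_forall_inner_eq_zero (x : M) {k : ℕ} (hk : k < finrank ℝ E)
    (a : Fin k → TangentSpace 𝓘(ℝ, E) x) :
    ∃ e : TangentSpace 𝓘(ℝ, E) x, inner ℝ e e ≠ (0 : ℝ) ∧ ∀ i, inner ℝ (a i) e = (0 : ℝ) := by
  have hk' : k < finrank ℝ (TangentSpace 𝓘(ℝ, E) x) := hk
  obtain ⟨e, h0, h⟩ := exists_ne_zero_forall_inner_eq_zero hk' a
  exact ⟨e, inner_self_ne_zero.2 h0, h⟩

theorem IsTransSasakian.mvfderiv_xi (hS : S.IsTransSasakian α β) (hdim : 3 ≤ finrank ℝ E) (x : M) :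
    mvfderiv 𝓘(ℝ, E) α x (S.xi x) = -2 * α x * β x := by
  obtain ⟨e, he, h⟩ := exists_tangent_ne_zero_forall_inner_eq_zero x
    (show 1 < finrank ℝ E by lia) ![S.xi x]
  have h1 : inner ℝ (S.xi x) e = (0 : ℝ) := h 0
  -- Only the first cyclic term survives: `φ ξ = 0` kills the others, and `Ω(e, φ e) = ‖e‖²`.
  have h2 := hS.wedge_eq_zero x (S.xi x) e (S.phi x e)
  rw [S.inner_phi_phi, S.phi_xi, S.phi_skew x (S.phi x e), S.phi_xi, h1, S.inner_xi_xi] at h2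
  simp only [inner_zero_left, inner_zero_right] at h2
  have h3 : (mvfderiv 𝓘(ℝ, E) α x (S.xi x) + 2 * (α x * β x)) * inner ℝ e e = 0 := by
    linear_combination h2
  linear_combination (_root_.mul_eq_zero.1 h3).resolve_right he

theorem IsTransSasakian.mvfderiv_eq (hS : S.IsTransSasakian α β) (hdim : 5 ≤ finrank ℝ E) (x : M)
    (u : TangentSpace 𝓘(ℝ, E) x) :
    mvfderiv 𝓘(ℝ, E) α x u = -2 * (α x * β x * inner ℝ (S.xi x) u) := by
  -- Orthogonality to `u` and to `φ u` makes `Ω(φ e, u)` and `Ω(u, e)` vanish, which leaves the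
  -- coefficient at `u` times `‖e‖²`. These conditions are where the larger dimension is used.
  obtain ⟨e, he, h⟩ := exists_tangent_ne_zero_forall_inner_eq_zero x
    (show 3 < finrank ℝ E by lia) ![S.xi x, u, S.phi x u]
  have h1 : inner ℝ (S.xi x) e = (0 : ℝ) := h 0
  have h2 : inner ℝ u e = (0 : ℝ) := h 1
  have h3 : inner ℝ (S.phi x u) e = (0 : ℝ) := h 2
  have h4 := hS.wedge_eq_zero x u e (S.phi x e)
  rw [S.inner_phi_phi, S.phi_sq, h1, h3, zero_smul, add_zero, inner_neg_left,
    real_inner_comm u e, h2] at h4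
  have h5 : (mvfderiv 𝓘(ℝ, E) α x u + 2 * (α x * β x) * inner ℝ (S.xi x) u) * inner ℝ e e
      = 0 := by
    linear_combination h4
  linear_combination (_root_.mul_eq_zero.1 h5).resolve_right he

theorem IsTransSasakian.mul_eq_zero (hS : S.IsTransSasakian α β) (hdim : 5 ≤ finrank ℝ E) (x : M) :
    α x * β x = 0 := by
  obtain ⟨e, he, h⟩ := exists_tangent_ne_zero_forall_inner_eq_zero x
    (show 1 < finrank ℝ E by lia) ![S.xi x]
  have h1 : inner ℝ (S.xi x) e = (0 : ℝ) := h 0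
  have hα : ∀ᶠ y in 𝓝 x, CMDiffAt ∞ α y := .of_forall fun y ↦ hS.1 y
  have hαβ : MDiffAt (fun p ↦ α p * β p) x := (hS.1.mul hS.2.1).mdifferentiable (by simp) x
  -- This differentiates `dα = -2αβ η` along a second direction.
  have key (v w : TangentSpace 𝓘(ℝ, E) x) :
      mvfderiv 𝓘(ℝ, E) (fun p ↦ mvfderiv 𝓘(ℝ, E) α p (coordField x w p)) x v
        = -2 * (α x * β x * mvfderiv 𝓘(ℝ, E) (fun p ↦ inner ℝ (S.xi p) (coordField x w p)) x v
          + inner ℝ (S.xi x) w * mvfderiv 𝓘(ℝ, E) (fun p ↦ α p * β p) x v) := by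
    have hη := (S.eventually_contMDiffAt_inner_xi x w).self_of_nhds.mdifferentiableAt (by simp)
    simp only [hS.mvfderiv_eq hdim]
    have hm : MDiffAt (fun p ↦ α p * β p * inner ℝ (S.xi p) (coordField x w p)) x := hαβ.mul hη
    have h2 := mvfderiv_fun_mul (mdifferentiableAt_const (c := (-2 : ℝ))) hm
    have h3 := mvfderiv_fun_mul hαβ hη
    simp only [mvfderiv_const, smul_zero, add_zero] at h2 h3
    rw [h2, h3]
    simp only [add_apply, smul_apply, smul_eq_mul, coordField_self]
  have hc := mvfderiv_mvfderiv_coordField_comm hα e (S.phi x e)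
  have hd := hS.d_eta_coordField (mem_extChartAt_source x) e (S.phi x e)
  -- Both `e` and `φ e` are orthogonal to `ξ`, so the terms in `d(αβ)` drop out and `αβ dη(e, φ e) =
  -- 0` remains.
  rw [key, key, h1, S.inner_xi_phi] at hc
  simp only [coordField_self] at hd
  rw [S.inner_phi_phi, h1] at hd
  have h3 : (α x * α x * β x) * inner ℝ e e = 0 := by
    linear_combination (1 / 4) * hc + (1 / 2) * α x * β x * hd
  have h4 := (_root_.mul_eq_zero.1 h3).resolve_right he
  rcases _root_.mul_eq_zero.1 h4 with h5 | h5
  · rw [mul_self_eq_zero.1 h5, zero_mul]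
  · rw [h5, mul_zero]

end AlmostContactMetric

end

end ACM

end

theorem theorem4p7
    {E : Type*} [NormedAddCommGroup E] [NormedSpace ℝ E] [FiniteDimensional ℝ E]
    {M : Type*} [TopologicalSpace M] [T2Space M] [SecondCountableTopology M]
    [ChartedSpace E M] [IsManifold 𝓘(ℝ, E) ∞ M]
    [RiemannianBundle (fun x : M ↦ TangentSpace 𝓘(ℝ, E) x)]
    [IsContMDiffRiemannianBundle 𝓘(ℝ, E) ∞ E (fun x : M ↦ TangentSpace 𝓘(ℝ, E) x)]
    (hdim : 3 ≤ finrank ℝ E)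
    (S : ACM.AlmostContactMetric E M) (α β : M → ℝ) (hS : S.IsTransSasakian α β) :
    (∀ x, mvfderiv 𝓘(ℝ, E) α x (S.xi x) = -2 * α x * β x) ∧
    (5 ≤ finrank ℝ E →
      (∀ x, α x * β x = 0) ∧ (∀ x, ACM.grad E α x = 0) ∧
      (ConnectedSpace M →
        (S.IsAlphaSasakian α ∧ (∀ x, β x = 0) ∧ ∃ c : ℝ, ∀ x, α x = c) ∨
        (S.IsBetaKenmotsu β ∧ ∀ x, α x = 0))) := by
  refine ⟨hS.mvfderiv_xi hdim, fun h5 ↦ ?_⟩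
  have hz := hS.mul_eq_zero h5
  have hd (x : M) : mvfderiv 𝓘(ℝ, E) α x = 0 := by
    ext u
    rw [hS.mvfderiv_eq h5, hz]
    simp
  refine ⟨hz, fun x ↦ ?_, fun _ ↦ ?_⟩
  · rw [ACM.grad, hd]
    exact ext_inner_right ℝ fun w ↦ by rw [ACM.inner_sharp, inner_zero_left]; rfl
  obtain ⟨c, hc⟩ := ACM.exists_eq_const_of_mvfderiv_eq_zero hS.1 hd
  -- A constant `α` is identically zero or nowhere zero; in the second case `αβ = 0` forces `β = 0`.
  by_cases h0 : c = 0
  · have hα : α = fun _ ↦ 0 := funext fun x ↦ by rw [hc, h0]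
    subst hα
    exact .inr ⟨hS, fun _ ↦ rfl⟩
  · have hβ : β = fun _ ↦ 0 :=
      funext fun x ↦ (mul_eq_zero.1 (hz x)).resolve_left (by rw [hc]; exact h0)
    subst hβ
    exact .inl ⟨hS, fun _ ↦ rfl, c, hc⟩
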